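/- Let $(\mathbb S,d)$ be a complete separable metric space with Borel $\sigma$-algebra $\mathcal S$, let $\mathbb C\subset\mathbb S$ be closed and put $\mathbb O=\mathbb S\setminus\mathbb C$, $\mathcal S_{\mathbb O}=\{A\in\mathcal S: A\subset\mathbb O\}$ and $\mathbb C^r=\{x\in\mathbb S: d(x,\mathbb C)<r\}$ for $r>0$ (with $d(x,\emptyset)=\infty$). A set $A\in\mathcal S_{\mathbb O}$ is bounded away from $\mathbb C$ if $A\cap\mathbb C^r=\emptyset$ for some $r>0$. Let $\mathbb M_{\mathbb O}$ be the set of measures on $\mathcal S_{\mathbb O}$ that are finite on $\mathbb S\setminus\mathbb C^r$ for every $r>0$, with the $\sigma$-algebra generated by the sets $\{\nu\in\mathbb M_{\mathbb O}: |\int f_i\,d\nu-\int f_i\,d\mu|<\varepsilon,\ i=1,\dots,k\}$, where $\mu\in\mathbb M_{\mathbb O}$, $\varepsilon>0$ and $f_1,\dots,f_k$ are non-negative bounded continuous functions on $\mathbb O$, each vanishing on $\mathbb O\cap\mathbb C^r$ for some $r>0$. Let $\mathbb N_{\mathbb O}\subset\mathbb M_{\mathbb O}$, with the trace $\sigma$-algebra,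 be the set of those $\nu$ such that $\nu(A\setminus\mathbb C^r)$ is a non-negative integer for all $A\in\mathcal S$ and $r>0$. A point process on $\mathbb O$ is a measurable map $N$ from a probability space $(\Omega,\mathcal A,P)$ into $\mathbb N_{\mathbb O}$. Let $BM(\mathbb S)$ be the set of non-negative bounded measurable functions on $\mathbb S$ that vanish on $\mathbb C^r$ for some $r>0$; the Laplace functional of $N$ is $L_N[f]=E\exp\big(-\int_{\mathbb O} f\,dN\big)$, $f\in BM(\mathbb S)$. For $\mu\in\mathbb M_{\mathbb O}$, a point process $N$ is called a Poisson random measure with mean measure $\mu$, or $\mathrm{PRM}(\mu)$, if (i) for all $A\in\mathcal S_{\mathbb O}$ and all integers $k\ge 0$, $P(N(A)=k)=e^{-\mu(A)}\mu(A)^k/k!$ if $\mu(A)<\infty$, and $P(N(A)=k)=0$ if $\mu(A)=\infty$; (ii) for all $k\ge 1$ and all pairwise disjoint $A_1,\dots,A_k\in\mathcal S_{\mathbb O}$ bounded away from $\mathbb C$, the random variables $N(A_1),\dots,N(A_k)$ are independent. **Proposition.** Let $\mu\in\mathbb M_{\mathbb O}$. Then $\mathrm{PRM}(\mu)$ exists,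 and its law is uniquely determined by (i) and (ii): any two point processes satisfying (i) and (ii), on possibly different probability spaces, have the same distribution on $\mathbb N_{\mathbb O}$. Moreover, the Laplace functional of $\mathrm{PRM}(\mu)$ is $$L_N[f]=\exp\Big(-\int_{\mathbb O}\big(1-e^{-f(x)}\big)\,\mu(dx)\Big),\qquad f\in BM(\mathbb S),$$ and conversely every point process whose Laplace functional has this form for all $f\in BM(\mathbb S)$ is $\mathrm{PRM}(\mu)$. -/

import Mathlib

open MeasureTheory ProbabilityTheory
open scoped ENNReal BoundedContinuousFunction

universe u v w

namespace PRM

section Spaces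

variable {S : Type u} [MetricSpace S]

/-- `A ⊆ 𝕆 = S ∖ C` is bounded away from `C`: it is disjoint from
`C^r = {x | d(x, C) < r} = Metric.thickening r C` for some `r > 0`. -/
def BoundedAway (C : Set S) (A : Set ↥Cᶜ) : Prop :=
  ∃ r : ℝ, 0 < r ∧ ∀ x ∈ A, (x : S) ∉ Metric.thickening r C

/-- The class `𝒞_𝕆`: non-negative bounded continuous real functions on `𝕆 = S ∖ C` that vanish on
`C^r` for some `r > 0`. -/
def CO (C : Set S) : Set (↥Cᶜ →ᵇ ℝ) :=
  {f | (∀ x, 0 ≤ f x) ∧ ∃ r : ℝ, 0 < r ∧ ∀ x : ↥Cᶜ, (x : S) ∈ Metric.thickening r C → f x = 0}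

variable [MeasurableSpace S]

/-- The class `BM(S)`: non-negative bounded measurable real functions on `S` that vanish on `C^r`
for some `r > 0`. -/
def BM (C : Set S) : Set (S → ℝ) :=
  {f | Measurable f ∧ (∀ x, 0 ≤ f x) ∧ (∃ K : ℝ, ∀ x, f x ≤ K) ∧
    ∃ r : ℝ, 0 < r ∧ ∀ x ∈ Metric.thickening r C, f x = 0}

/-- The space `𝕄_𝕆` of Borel measures on `𝕆 = S ∖ C` that are finite on `S ∖ C^r` for all
`r > 0`. -/
def MO (C : Set S) : Type u :=
  {μ : Measure ↥Cᶜ // ∀ r : ℝ, 0 < r → μ {x | (x : S) ∉ Metric.thickening r C} < ∞}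

/-- The underlying measure on `𝕆` of an element of `𝕄_𝕆`. -/
def MO.toMeasure {C : Set S} (μ : MO C) : Measure ↥Cᶜ := μ.1

/-- The basic neighbourhood
`{ν ∈ 𝕄_𝕆 : |∫ f_i dν - ∫ f_i dμ| < ε, i = 1, …, k}` of `μ`. -/
def MO.nhd {C : Set S} (μ : MO C) {k : ℕ} (f : Fin k → (↥Cᶜ →ᵇ ℝ)) (ε : ℝ) : Set (MO C) :=
  {ν | ∀ i, |∫ x, f i x ∂ν.toMeasure - ∫ x, f i x ∂μ.toMeasure| < ε}

/-- The σ-algebra on `𝕄_𝕆` generated by the basic neighbourhoods given by functions in `𝒞_𝕆`. -/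
instance MO.instMeasurableSpace (C : Set S) : MeasurableSpace (MO C) :=
  MeasurableSpace.generateFrom
    {U | ∃ (μ : MO C) (k : ℕ) (f : Fin k → (↥Cᶜ →ᵇ ℝ)) (ε : ℝ),
      (∀ i, f i ∈ CO C) ∧ 0 < ε ∧ U = μ.nhd f ε}

/-- `ν ∈ 𝕄_𝕆` is a counting measure: `ν(A ∖ C^r)` is a non-negative integer for all `r > 0` and
all Borel sets `A ⊆ S`. -/
def MO.IsCounting {C : Set S} (ν : MO C) : Prop :=
  ∀ r : ℝ, 0 < r → ∀ A : Set S, MeasurableSet A →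
    ∃ n : ℕ, ν.toMeasure {x | (x : S) ∈ A \ Metric.thickening r C} = n

/-- The space `ℕ_𝕆` of counting measures in `𝕄_𝕆`. -/
def NO (C : Set S) : Type u := {ν : MO C // ν.IsCounting}

/-- An element of `ℕ_𝕆` as an element of `𝕄_𝕆`. -/
def NO.toMO {C : Set S} (N : NO C) : MO C := N.1

/-- The underlying measure on `𝕆` of a counting measure. -/
def NO.toMeasure {C : Set S} (N : NO C) : Measure ↥Cᶜ := N.toMO.toMeasure

/-- `ℕ_𝕆` carries the trace of the σ-algebra of `𝕄_𝕆`. -/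
instance NO.instMeasurableSpace (C : Set S) : MeasurableSpace (NO C) :=
  MeasurableSpace.comap NO.toMO inferInstance

end Spaces

section Processes

variable {S : Type u} [MetricSpace S] [MeasurableSpace S] {C : Set S}
  {Ω : Type v} [MeasurableSpace Ω]

/-- The Laplace functional `L_ξ[f] = E[exp(-∫_𝕆 f dξ)]` of a random measure `ξ`. -/
noncomputable def laplace (P : Measure Ω) (ξ : Ω → MO C) (f : S → ℝ) : ℝ :=
  ∫ ω, Real.exp (-∫ x : ↥Cᶜ, f x ∂(ξ ω).toMeasure) ∂P

/-- A point process on `𝕆`: a measurable map from a probability space into `ℕ_𝕆`. -/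
structure IsPointProcess (P : Measure Ω) (N : Ω → NO C) : Prop where
  isProbabilityMeasure : IsProbabilityMeasure P
  measurable : Measurable N

/-- `N` is a Poisson random measure with mean measure `μ`, `PRM(μ)`. -/
structure IsPRM (μ : MO C) (P : Measure Ω) (N : Ω → NO C) : Prop where
  isPointProcess : IsPointProcess P N
  poisson_of_lt_top : ∀ A : Set ↥Cᶜ, MeasurableSet A → ∀ k : ℕ, μ.toMeasure A < ∞ →
    P {ω | (N ω).toMeasure A = k} =
      ENNReal.ofReal (Real.exp (-(μ.toMeasure A).toReal) * (μ.toMeasure A).toReal ^ k /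
        (Nat.factorial k : ℝ))
  poisson_of_eq_top : ∀ A : Set ↥Cᶜ, MeasurableSet A → ∀ k : ℕ, μ.toMeasure A = ∞ →
    P {ω | (N ω).toMeasure A = k} = 0
  indep : ∀ (k : ℕ) (A : Fin k → Set ↥Cᶜ), 1 ≤ k → (∀ i, MeasurableSet (A i)) →
    (∀ i, BoundedAway C (A i)) → Pairwise (fun i j => Disjoint (A i) (A j)) →
    iIndepFun (fun i ω => (N ω).toMeasure (A i)) P

/-- The Laplace functional of `N` is `f ↦ exp(-∫_𝕆 (1 - e^{-f}) dμ)` on `BM(S)`. -/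
def HasPoissonLaplace (μ : MO C) (P : Measure Ω) (N : Ω → NO C) : Prop :=
  ∀ f ∈ BM C, laplace P (fun ω => (N ω).toMO) f =
    Real.exp (-∫ x : ↥Cᶜ, (1 - Real.exp (-f x)) ∂μ.toMeasure)

end Processes

end PRM

/-! All four claims go through the Laplace functional. The σ-algebra of `NO C` is generated by the
integrals of functions in `CO C`, and a finite measure on an orthant is determined by its Laplace
transform (`ext_of_laplaceTransform_eq`); hence the Laplace functional determines the law of a point
process (`map_eq_of_laplace_eq`).

For a PRM it is computed on simple functions, where independence and the Poisson generating function
apply, and then by dominated convergence (`IsPRM.laplace_eq`). Uniqueness follows.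

Conversely, inserting combinations of indicators of disjoint sets bounded away from `C` identifies
the joint law of the counts as a product of Poisson laws. An arbitrary Borel set is exhausted by its
parts outside `C^r` (`isPRM_of_laplace`).

For existence, 𝕆 is cut into annuli of finite mass, each receiving an independent Poisson number of
i.i.d. points. By the converse, only the Laplace functional of the superposition has to be computed
(`exists_isPRM`). -/

open Filter Topology
open scoped NNReal

namespace PRM

/-! ### Laplace transforms on the orthant and the Poisson generating function. -/

section LaplaceTransform

variable {ι : Type*} [Fintype ι]

/-- The bounded continuous function `x ↦ exp (-∑ i, t i * x i)` on the orthant `ι → ℝ≥0`. -/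
noncomputable def expNegBCF (t : ι → ℝ≥0) : (ι → ℝ≥0) →ᵇ ℝ :=
  BoundedContinuousFunction.ofNormedAddCommGroup
    (fun x => Real.exp (-∑ i, (t i : ℝ) * x i)) (by fun_prop) 1 (fun x => by
      rw [Real.norm_eq_abs, Real.abs_exp, Real.exp_le_one_iff, neg_nonpos]
      positivity)

lemma expNegBCF_apply (t x : ι → ℝ≥0) :
    expNegBCF t x = Real.exp (-∑ i, (t i : ℝ) * x i) := rfl

/-- The functions `expNegBCF t` form a submonoid. -/
noncomputable def expNegSubmonoid (ι : Type*) [Fintype ι] : Submonoid ((ι → ℝ≥0) →ᵇ ℝ) where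
  carrier := Set.range expNegBCF
  one_mem' := ⟨0, by ext x; simp [expNegBCF_apply]⟩
  mul_mem' := by
    rintro _ _ ⟨s, rfl⟩ ⟨t, rfl⟩
    refine ⟨s + t, ?_⟩
    ext x
    simp [expNegBCF_apply, ← Real.exp_add, add_mul, Finset.sum_add_distrib, add_comm]

/-- The star subalgebra spanned by the functions `expNegBCF t`. -/
noncomputable def expNegAlgebra (ι : Type*) [Fintype ι] :
    StarSubalgebra ℝ ((ι → ℝ≥0) →ᵇ ℝ) where
  toSubalgebra := Algebra.adjoin ℝ (expNegSubmonoid ι : Set ((ι → ℝ≥0) →ᵇ ℝ))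
  star_mem' := by
    intro f hf
    rwa [show star f = f by ext x; simp]

/-- A finite measure on the orthant `ι → ℝ≥0` is determined by its Laplace transform. -/
theorem ext_of_laplaceTransform_eq {P Q : Measure (ι → ℝ≥0)} [IsFiniteMeasure P]
    [IsFiniteMeasure Q]
    (h : ∀ t : ι → ℝ≥0, ∫ x, Real.exp (-∑ i, (t i : ℝ) * x i) ∂P =
      ∫ x, Real.exp (-∑ i, (t i : ℝ) * x i) ∂Q) : P = Q := by
  classical
  -- A point-separating algebra of bounded continuous functions determines a finite measure. Since
  -- the exponentials are closed under products, the algebra is their linear span, and the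
  -- hypothesis extends to it by linearity.
  refine ext_of_forall_mem_subalgebra_integral_eq_of_pseudoEMetric_complete_countable
    (A := expNegAlgebra ι) (𝕜 := ℝ) ?_ ?_
  · intro x y hxy
    obtain ⟨i, hi⟩ := Function.ne_iff.1 hxy
    refine ⟨_, ⟨_, ⟨expNegBCF (Pi.single i 1), ?_, rfl⟩, rfl⟩, ?_⟩
    · exact Algebra.subset_adjoin ⟨_, rfl⟩
    · simpa [expNegBCF_apply, Pi.single_apply, apply_ite NNReal.toReal] using hi
  · intro g hg
    have hg' : g ∈ Submodule.span ℝ (expNegSubmonoid ι : Set ((ι → ℝ≥0) →ᵇ ℝ)) := by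
      have : g ∈ Algebra.adjoin ℝ (expNegSubmonoid ι : Set ((ι → ℝ≥0) →ᵇ ℝ)) := hg
      rw [← Subalgebra.mem_toSubmodule, Algebra.adjoin_eq_span, Submonoid.closure_eq] at this
      exact this
    clear hg
    induction hg' using Submodule.span_induction with
    | mem f hf =>
      obtain ⟨t, rfl⟩ := hf
      exact h t
    | zero => simp
    | add f g hf hg ihf ihg =>
      simp only [BoundedContinuousFunction.coe_add, Pi.add_apply]
      rw [integral_add (f.integrable _) (g.integrable _),
        integral_add (f.integrable _) (g.integrable _), ihf, ihg]
    | smul c f hf ih =>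
      simp only [BoundedContinuousFunction.coe_smul]
      rw [integral_smul, integral_smul, ih]

/-- The probability generating function of the Poisson distribution. -/
lemma integral_pow_poissonMeasure (r : ℝ≥0) (z : ℝ) :
    ∫ n, z ^ n ∂(poissonMeasure r) = Real.exp (-(r * (1 - z))) := by
  rw [integral_poissonMeasure]
  have : ∀ n : ℕ, (Real.exp (-r) * (r : ℝ) ^ n / n.factorial) • z ^ n =
      Real.exp (-r) * ((r * z) ^ n / n.factorial) := fun n => by
    rw [smul_eq_mul, mul_pow]; ring
  simp_rw [this]
  rw [tsum_mul_left, (NormedSpace.expSeries_div_hasSum_exp ((r : ℝ) * z)).tsum_eq,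
    ← Real.exp_eq_exp_ℝ, ← Real.exp_add]
  ring_nf

end LaplaceTransform

/-! ### Exhaustion of 𝕆 by the sets S ∖ C^r. -/

section Far

variable {S : Type u} [MetricSpace S] {C : Set S}

/-- The subset `S ∖ C^r` of `𝕆 = S ∖ C`. -/
def far (C : Set S) (r : ℝ) : Set ↥Cᶜ := {x | (x : S) ∉ Metric.thickening r C}

lemma far_anti {r s : ℝ} (h : r ≤ s) : far C s ⊆ far C r :=
  fun _ hx hx' => hx (Metric.thickening_mono h C hx')

lemma isClosed_far (r : ℝ) : IsClosed (far C r) :=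
  (Metric.isOpen_thickening.isClosed_compl).preimage continuous_subtype_val

lemma monotone_far_one_div : Monotone fun n : ℕ => far C (1 / ((n : ℝ) + 1)) :=
  fun _ _ h => far_anti (Nat.one_div_le_one_div h)

/-- Closedness of `C` enters here: a point off `C` has a ball missing `C`. This exhaustion carries
every passage from sets bounded away from `C` to arbitrary Borel sets. -/
lemma iUnion_far (hC : IsClosed C) : ⋃ n : ℕ, far C (1 / ((n : ℝ) + 1)) = Set.univ := by
  refine Set.eq_univ_of_forall fun x => ?_
  obtain ⟨ε, hε, hb⟩ := Metric.isOpen_iff.1 hC.isOpen_compl x x.2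
  obtain ⟨n, hn⟩ := exists_nat_one_div_lt hε
  refine Set.mem_iUnion.2 ⟨n, fun hx => ?_⟩
  obtain ⟨z, hz, hxz⟩ := Metric.mem_thickening_iff.1 hx
  exact hb (Metric.mem_ball.2 ((dist_comm z (x : S)).trans_lt (hxz.trans hn))) hz

lemma boundedAway_iff {A : Set ↥Cᶜ} : BoundedAway C A ↔ ∃ r : ℝ, 0 < r ∧ A ⊆ far C r := Iff.rfl

/-- A continuous cutoff function vanishing on `C^r` and equal to `1` off `C^(2r)`. -/
lemma exists_cutoff {r : ℝ} (hr : 0 < r) (C : Set S) : ∃ φ : ↥Cᶜ →ᵇ ℝ, φ ∈ CO C ∧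
    (∀ x, φ x ≤ 1) ∧ ∀ x ∈ far C (r + r), φ x = 1 := by
  let θ := thickenedIndicator hr (Metric.thickening r C)
  have hθ : ∀ y, θ y ≤ 1 := thickenedIndicator_le_one hr _
  refine ⟨BoundedContinuousFunction.ofNormedAddCommGroup (fun x => 1 - (θ x : ℝ)) (by fun_prop) 1
    (fun x => ?_), ⟨fun x => ?_, r, hr, fun x hx => ?_⟩, fun x => ?_, fun x hx => ?_⟩
  · have h1 : (θ x : ℝ) ≤ 1 := hθ x
    rw [Real.norm_eq_abs, abs_le]
    constructor <;> linarith [(θ x).2]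
  · have h1 : (θ x : ℝ) ≤ 1 := hθ x
    simpa using h1
  · have : θ x = 1 := thickenedIndicator_one hr _ hx
    simp [this]
  · simp
  · have : θ x = 0 := thickenedIndicator_zero hr _
      fun h => hx (Metric.thickening_thickening_subset _ _ _ h)
    simp [this]

end Far

/-! ### Test functions on 𝕆. -/

section Test

variable {S : Type u} [MetricSpace S] [MeasurableSpace S] {C : Set S}

/-- Non-negative bounded measurable functions on `𝕆 = S ∖ C` vanishing on `C^r` for some
`r > 0`. -/
structure IsTest (g : ↥Cᶜ → ℝ) : Prop where
  measurable : Measurable g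
  nonneg : ∀ x, 0 ≤ g x
  bounded : ∃ K : ℝ, ∀ x, g x ≤ K
  vanish : ∃ r : ℝ, 0 < r ∧ ∀ x, x ∉ far C r → g x = 0

lemma IsTest.of_mem_BM {f : S → ℝ} (hf : f ∈ BM C) : IsTest (fun x : ↥Cᶜ => f x) := by
  obtain ⟨hm, h0, ⟨K, hK⟩, r, hr, hv⟩ := hf
  exact ⟨hm.comp measurable_subtype_coe, fun x => h0 x, ⟨K, fun x => hK x⟩, r, hr,
    fun x hx => hv x (not_not.1 hx)⟩

lemma IsTest.of_le {g h : ↥Cᶜ → ℝ} (hg : IsTest g) (hm : Measurable h) (h0 : ∀ x, 0 ≤ h x)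
    (hle : ∀ x, h x ≤ g x) : IsTest h := by
  obtain ⟨K, hK⟩ := hg.bounded
  obtain ⟨r, hr, hv⟩ := hg.vanish
  exact ⟨hm, h0, ⟨K, fun x => (hle x).trans (hK x)⟩, r, hr,
    fun x hx => le_antisymm ((hle x).trans (hv x hx).le) (h0 x)⟩

/-- From 1 - e^(-g) ≤ g; it makes the exponent of the Poisson Laplace functional a convergent
integral. -/
lemma IsTest.one_sub_exp_neg {g : ↥Cᶜ → ℝ} (hg : IsTest g) :
    IsTest (fun x => 1 - Real.exp (-g x)) := by
  refine hg.of_le ?_ (fun x => ?_) (fun x => ?_)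
  · have := hg.measurable
    fun_prop
  · have : Real.exp (-g x) ≤ 1 := Real.exp_le_one_iff.2 (neg_nonpos.2 (hg.nonneg x))
    linarith
  · have := Real.add_one_le_exp (-g x)
    linarith

lemma IsTest.zero : IsTest (fun _ : ↥Cᶜ => (0 : ℝ)) :=
  ⟨measurable_const, fun _ => le_rfl, ⟨0, fun _ => le_rfl⟩, 1, one_pos, fun _ _ => rfl⟩

lemma IsTest.const_mul {g : ↥Cᶜ → ℝ} (hg : IsTest g) {c : ℝ} (hc : 0 ≤ c) :
    IsTest (fun x => c * g x) := by
  obtain ⟨K, hK⟩ := hg.bounded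
  obtain ⟨r, hr, hv⟩ := hg.vanish
  exact ⟨hg.measurable.const_mul c, fun x => mul_nonneg hc (hg.nonneg x),
    ⟨c * K, fun x => mul_le_mul_of_nonneg_left (hK x) hc⟩, r, hr, fun x hx => by simp [hv x hx]⟩

lemma IsTest.add {g h : ↥Cᶜ → ℝ} (hg : IsTest g) (hh : IsTest h) :
    IsTest (fun x => g x + h x) := by
  obtain ⟨K, hK⟩ := hg.bounded
  obtain ⟨r, hr, hv⟩ := hg.vanish
  obtain ⟨L, hL⟩ := hh.bounded
  obtain ⟨s, hs, hw⟩ := hh.vanish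
  refine ⟨hg.measurable.add hh.measurable, fun x => add_nonneg (hg.nonneg x) (hh.nonneg x),
    ⟨K + L, fun x => add_le_add (hK x) (hL x)⟩, min r s, lt_min hr hs, fun x hx => ?_⟩
  rw [hv x fun h => hx (far_anti (min_le_left _ _) h),
    hw x fun h => hx (far_anti (min_le_right _ _) h), add_zero]

lemma IsTest.sum {ι : Type*} (s : Finset ι) {g : ι → ↥Cᶜ → ℝ} (hg : ∀ i, IsTest (g i)) :
    IsTest (fun x => ∑ i ∈ s, g i x) := by
  classical
  induction s using Finset.induction_on with
  | empty => simpa using IsTest.zero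
  | insert a s ha ih => simpa [Finset.sum_insert ha] using (hg a).add ih

lemma IsTest.indicator_one {A : Set ↥Cᶜ} (hA : MeasurableSet A) (hb : BoundedAway C A) :
    IsTest (A.indicator fun _ => (1 : ℝ)) := by
  obtain ⟨r, hr, hAr⟩ := boundedAway_iff.1 hb
  refine ⟨measurable_const.indicator hA, fun x => Set.indicator_nonneg (fun _ _ => zero_le_one) x,
    ⟨1, fun x => Set.indicator_le_self' (fun _ _ => zero_le_one) x⟩, r, hr, fun x hx => ?_⟩
  exact Set.indicator_of_notMem (fun h => hx (hAr h)) _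

lemma MO.measure_far_lt_top (ν : MO C) {r : ℝ} (hr : 0 < r) : ν.toMeasure (far C r) < ∞ := ν.2 r hr

lemma MO.measure_lt_top_of_boundedAway (ν : MO C) {A : Set ↥Cᶜ} (hA : BoundedAway C A) :
    ν.toMeasure A < ∞ := by
  obtain ⟨r, hr, h⟩ := boundedAway_iff.1 hA
  exact (measure_mono h).trans_lt (ν.measure_far_lt_top hr)

/-- A bounded function supported on a set of finite measure. Thus the Bochner integrals of test
functions never take the default value 0. -/
lemma IsTest.integrable {g : ↥Cᶜ → ℝ} (hg : IsTest g) (ν : MO C) : Integrable g ν.toMeasure := by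
  obtain ⟨K, hK⟩ := hg.bounded
  obtain ⟨r, hr, hv⟩ := hg.vanish
  refine IntegrableOn.integrable_of_forall_notMem_eq_zero (s := far C r) ?_ hv
  refine Measure.integrableOn_of_bounded (M := K) (ν.measure_far_lt_top hr).ne
    hg.measurable.aestronglyMeasurable (ae_of_all _ fun x => ?_)
  rw [Real.norm_of_nonneg (hg.nonneg x)]
  exact hK x

/-- Extension by zero of a test function from `𝕆` to `S`. -/
lemma IsTest.exists_mem_BM (hC : MeasurableSet C) {g : ↥Cᶜ → ℝ} (hg : IsTest g) :
    ∃ f ∈ BM C, ∀ x : ↥Cᶜ, f x = g x := by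
  obtain ⟨K, hK⟩ := hg.bounded
  obtain ⟨r, hr, hv⟩ := hg.vanish
  have hval : ∀ x : ↥Cᶜ, Function.extend Subtype.val g (fun _ => 0) x = g x :=
    fun x => Subtype.val_injective.extend_apply _ _ _
  have hout : ∀ x : S, x ∈ C → Function.extend Subtype.val g (fun _ => 0) x = 0 := by
    intro x hx
    rw [Function.extend_apply']
    rintro ⟨y, rfl⟩
    exact y.2 hx
  refine ⟨Function.extend Subtype.val g fun _ => 0, ⟨?_, fun x => ?_, ⟨max K 0, fun x => ?_⟩, r, hr,
    fun x hx => ?_⟩, hval⟩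
  · exact (MeasurableEmbedding.subtype_coe hC.compl).measurable_extend hg.measurable
      measurable_const
  all_goals by_cases hxC : x ∈ C
  · rw [hout x hxC]
  · exact (hval ⟨x, hxC⟩).symm ▸ hg.nonneg _
  · rw [hout x hxC]; exact le_max_right _ _
  · exact (hval ⟨x, hxC⟩).symm ▸ (hK _).trans (le_max_left _ _)
  · exact hout x hxC
  · exact (hval ⟨x, hxC⟩).trans (hv _ fun h => h hx)

/-- Functions in `BM C` enter only through their restrictions to 𝕆, and extension by zero recovers
every test function; from here on one works on 𝕆 alone. -/
lemma hasPoissonLaplace_iff (hC : MeasurableSet C) {Ω : Type v} [MeasurableSpace Ω] {μ : MO C}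
    {P : Measure Ω} {N : Ω → NO C} : HasPoissonLaplace μ P N ↔
    ∀ g : ↥Cᶜ → ℝ, IsTest g → ∫ ω, Real.exp (-∫ x, g x ∂(N ω).toMeasure) ∂P =
      Real.exp (-∫ x, (1 - Real.exp (-g x)) ∂μ.toMeasure) := by
  refine ⟨fun h g hg => ?_, fun h f hf => h _ (IsTest.of_mem_BM hf)⟩
  obtain ⟨f, hf, hfg⟩ := hg.exists_mem_BM hC
  have := h f hf
  simp only [laplace, hfg] at this
  exact this

/-- The zero measure as an element of `𝕄_𝕆`. -/
def MO.zero (C : Set S) : MO C := ⟨0, fun _ _ => by simp⟩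

/-- A map into `𝕄_𝕆` is measurable if its integrals of functions in `𝒞_𝕆` are. -/
lemma MO.measurable_of_integral {Ω : Type*} [MeasurableSpace Ω] {ξ : Ω → MO C}
    (h : ∀ f ∈ CO C, Measurable fun ω => ∫ x, f x ∂(ξ ω).toMeasure) : Measurable ξ := by
  refine measurable_generateFrom ?_
  rintro _ ⟨μ, k, f, ε, hf, -, rfl⟩
  have : ξ ⁻¹' (μ.nhd f ε) = ⋂ i, {ω | |∫ x, f i x ∂(ξ ω).toMeasure -
      ∫ x, f i x ∂μ.toMeasure| < ε} := by
    ext ω; simp [MO.nhd]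
  rw [this]
  refine MeasurableSet.iInter fun i => ?_
  exact measurableSet_lt ((measurable_norm.comp ((h _ (hf i)).sub_const _))) measurable_const

lemma MO.measurable_integral {f : ↥Cᶜ →ᵇ ℝ} (hf : f ∈ CO C) :
    Measurable fun ν : MO C => ∫ x, f x ∂ν.toMeasure := by
  refine measurable_of_Iio fun c => ?_
  by_cases hc : 0 < c
  -- Since f ≥ 0, the set where the integral is below c is a basic neighbourhood of the zero
  -- measure.
  · refine MeasurableSpace.measurableSet_generateFrom
      ⟨MO.zero C, 1, fun _ => f, c, fun _ => hf, hc, ?_⟩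
    ext ν
    have h0 : 0 ≤ ∫ x, f x ∂ν.toMeasure := integral_nonneg hf.1
    simp [MO.nhd, MO.zero, MO.toMeasure] at h0 ⊢
    rw [abs_of_nonneg h0]
  · convert MeasurableSet.empty
    ext ν
    have h0 : 0 ≤ ∫ x, f x ∂ν.toMeasure := integral_nonneg hf.1
    simp only [Set.mem_preimage, Set.mem_Iio, Set.mem_empty_iff_false, iff_false, not_lt]
    linarith

lemma NO.measurable_toMO : Measurable (NO.toMO : NO C → MO C) := comap_measurable _

end Test

/-! ### Measurability of evaluations and integrals. -/

section Measurability

variable {S : Type u} [MetricSpace S] [MeasurableSpace S] [BorelSpace S] {C : Set S}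

lemma measurableSet_far (r : ℝ) : MeasurableSet (far C r) := (isClosed_far r).measurableSet

lemma IsTest.of_mem_CO {f : ↥Cᶜ →ᵇ ℝ} (hf : f ∈ CO C) : IsTest (fun x => f x) := by
  obtain ⟨h0, r, hr, hv⟩ := hf
  exact ⟨f.continuous.measurable, h0, ⟨‖f‖, fun x => (le_abs_self _).trans (f.norm_coe_le_norm x)⟩,
    r, hr, fun x hx => hv x (not_not.1 hx)⟩

lemma MO.measurable_lintegral {f : ↥Cᶜ →ᵇ ℝ} (hf : f ∈ CO C) :
    Measurable fun ν : MO C => ∫⁻ x, ENNReal.ofReal (f x) ∂ν.toMeasure := by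
  have : (fun ν : MO C => ∫⁻ x, ENNReal.ofReal (f x) ∂ν.toMeasure) =
      fun ν => ENNReal.ofReal (∫ x, f x ∂ν.toMeasure) := by
    ext ν
    rw [ofReal_integral_eq_lintegral_ofReal ((IsTest.of_mem_CO hf).integrable ν)
      (ae_of_all _ hf.1)]
  rw [this]
  exact (MO.measurable_integral hf).ennreal_ofReal

/-- The weight φ makes the measures finite, so closed sets suffice as a π-system. Indicators of
closed sets are limits of thickened indicators, whose products with φ remain in `CO C`. -/
lemma MO.measurable_withDensity_cutoff {φ : ↥Cᶜ →ᵇ ℝ} (hφ : φ ∈ CO C) :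
    Measurable fun ν : MO C => ν.toMeasure.withDensity fun x => ENNReal.ofReal (φ x) := by
  have hφm : Measurable fun x => ENNReal.ofReal (φ x) := φ.continuous.measurable.ennreal_ofReal
  have hfin : ∀ ν : MO C,
      IsFiniteMeasure (ν.toMeasure.withDensity fun x => ENNReal.ofReal (φ x)) := fun ν =>
    isFiniteMeasure_withDensity_ofReal ((IsTest.of_mem_CO hφ).integrable ν).2
  refine Measurable.measure_of_isPiSystem (borel_eq_generateFrom_isClosed (α := ↥Cᶜ) ▸
    BorelSpace.measurable_eq) isPiSystem_isClosed (fun F hF => ?_) ?_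
  · have hδ : ∀ n : ℕ, (0 : ℝ) < 1 / ((n : ℝ) + 1) := fun n => Nat.one_div_pos_of_nat
    refine measurable_of_tendsto_metrizable
      (f := fun n ν => ∫⁻ x, (thickenedIndicator (hδ n) F x : ℝ≥0∞)
        ∂(ν.toMeasure.withDensity fun x => ENNReal.ofReal (φ x))) (fun n => ?_)
      (tendsto_pi_nhds.2 fun ν => tendsto_lintegral_thickenedIndicator_of_isClosed _ hF hδ
        tendsto_one_div_add_atTop_nhds_zero_nat)
    let ψ : ↥Cᶜ →ᵇ ℝ := BoundedContinuousFunction.ofNormedAddCommGroup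
      (fun x => φ x * (thickenedIndicator (hδ n) F x : ℝ)) (by fun_prop) ‖φ‖ (fun x => by
        rw [norm_mul]
        refine (mul_le_of_le_one_right (norm_nonneg _) ?_).trans (φ.norm_coe_le_norm x)
        simpa using thickenedIndicator_le_one (hδ n) F x)
    have hψ : ψ ∈ CO C := by
      obtain ⟨h0, r, hr, hv⟩ := hφ
      refine ⟨fun x => mul_nonneg (h0 x) (NNReal.coe_nonneg _), r, hr, fun x hx => ?_⟩
      change φ x * _ = 0
      rw [hv x hx, zero_mul]
    convert MO.measurable_lintegral hψ using 2 with ν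
    rw [lintegral_withDensity_eq_lintegral_mul _ hφm (by fun_prop)]
    refine lintegral_congr fun x => ?_
    change ENNReal.ofReal (φ x) * _ = ENNReal.ofReal (φ x * _)
    rw [ENNReal.ofReal_mul (hφ.1 x), ENNReal.ofReal_coe_nnreal]
  · simpa using MO.measurable_lintegral hφ

/-- Evaluation at a Borel set is measurable on `𝕄_𝕆`. -/
theorem MO.measurable_toMeasure (hC : IsClosed C) :
    Measurable (MO.toMeasure : MO C → Measure ↥Cᶜ) := by
  refine Measure.measurable_of_measurable_coe _ fun A hA => ?_
  have hmono : Monotone fun n : ℕ => A ∩ far C (1 / ((n : ℝ) + 1)) :=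
    fun m n h => Set.inter_subset_inter_right A (monotone_far_one_div h)
  have hA' : A = ⋃ n : ℕ, A ∩ far C (1 / ((n : ℝ) + 1)) := by
    rw [← Set.inter_iUnion, iUnion_far hC, Set.inter_univ]
  have heq : (fun ν : MO C => ν.toMeasure A) =
      fun ν => ⨆ n : ℕ, ν.toMeasure (A ∩ far C (1 / ((n : ℝ) + 1))) := by
    ext ν
    conv_lhs => rw [hA']
    exact hmono.measure_iUnion
  rw [heq]
  refine Measurable.iSup fun n => ?_
  have hn : (0 : ℝ) < 1 / ((n : ℝ) + 1) := Nat.one_div_pos_of_nat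
  -- With half the radius, φ equals 1 on the whole n-th far set, so weighting by φ does not change
  -- the measure there.
  obtain ⟨φ, hφ, -, h1⟩ := exists_cutoff (half_pos hn) C
  rw [add_halves] at h1
  have hAn : MeasurableSet (A ∩ far C (1 / ((n : ℝ) + 1))) := hA.inter (measurableSet_far _)
  convert (Measure.measurable_coe hAn).comp (MO.measurable_withDensity_cutoff hφ) using 2 with ν
  rw [Function.comp_apply, withDensity_apply _ hAn, ← setLIntegral_one]
  refine setLIntegral_congr_fun hAn fun x hx => ?_
  simp [h1 x hx.2]

lemma NO.measurable_toMeasure (hC : IsClosed C) :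
    Measurable (NO.toMeasure : NO C → Measure ↥Cᶜ) :=
  (MO.measurable_toMeasure hC).comp NO.measurable_toMO

lemma NO.measurable_coe (hC : IsClosed C) {A : Set ↥Cᶜ} (hA : MeasurableSet A) :
    Measurable fun ν : NO C => ν.toMeasure A :=
  (Measure.measurable_coe hA).comp (NO.measurable_toMeasure hC)

lemma NO.measurable_integral (hC : IsClosed C) {g : ↥Cᶜ → ℝ} (hg : IsTest g) :
    Measurable fun ν : NO C => ∫ x, g x ∂ν.toMeasure := by
  have : (fun ν : NO C => ∫ x, g x ∂ν.toMeasure) =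
      fun ν => (∫⁻ x, ENNReal.ofReal (g x) ∂ν.toMeasure).toReal := by
    ext ν
    exact integral_eq_lintegral_of_nonneg_ae (ae_of_all _ hg.nonneg)
      hg.measurable.aestronglyMeasurable
  rw [this]
  exact ((Measure.measurable_lintegral hg.measurable.ennreal_ofReal).comp
    (NO.measurable_toMeasure hC)).ennreal_toReal

/-- A counting measure takes natural values on sets bounded away from `C`. -/
lemma NO.exists_nat (hC : IsClosed C) (ν : NO C) {A : Set ↥Cᶜ} (hA : MeasurableSet A)
    (hb : BoundedAway C A) : ∃ n : ℕ, ν.toMeasure A = n := by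
  obtain ⟨r, hr, h⟩ := hb
  obtain ⟨n, hn⟩ := ν.2 r hr _
    ((MeasurableEmbedding.subtype_coe hC.measurableSet.compl).measurableSet_image.2 hA)
  refine ⟨n, hn ▸ congrArg _ ?_⟩
  ext x
  simp only [Set.mem_ofPred_eq, Set.mem_sdiff, Subtype.val_injective.mem_set_image]
  exact ⟨fun hx => ⟨hx, h x hx⟩, fun hx => hx.1⟩

end Measurability

/-! ### Integrals against `CO C` as coordinates on the space of counting measures. -/

section Integrals

variable {S : Type u} [MetricSpace S] [MeasurableSpace S] {C : Set S}

/-- The integrals of a counting measure against all functions in `𝒞_𝕆`. -/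
noncomputable def NO.integrals (ν : NO C) (f : CO C) : ℝ≥0 :=
  (∫ x, f.1 x ∂ν.toMeasure).toNNReal

/-- The σ-algebra of `NO C` is pulled back from a product space, so laws may be compared after
mapping to that product. -/
lemma NO.exists_preimage_integrals {s : Set (NO C)} (hs : MeasurableSet s) :
    ∃ B : Set (CO C → ℝ≥0), MeasurableSet B ∧ NO.integrals ⁻¹' B = s := by
  have key : @Measurable _ _ (MeasurableSpace.comap NO.integrals inferInstance) _
      (NO.toMO : NO C → MO C) := by
    refine @MO.measurable_of_integral _ _ _ _ _ (MeasurableSpace.comap NO.integrals inferInstance)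
      _ fun f hf => ?_
    have : (fun ν : NO C => ∫ x, f x ∂ν.toMO.toMeasure) =
        fun ν => (NO.integrals ν ⟨f, hf⟩ : ℝ) := by
      ext ν
      exact (Real.coe_toNNReal _ (integral_nonneg hf.1)).symm
    rw [this]
    exact measurable_coe_nnreal_real.comp
      ((measurable_pi_apply (X := fun _ : CO C => ℝ≥0) ⟨f, hf⟩).comp
        (comap_measurable NO.integrals))
  exact key.comap_le s hs

end Integrals

/-! ### The Laplace functional determines the law. -/

section Law

variable {S : Type u} [MetricSpace S] [MeasurableSpace S] [BorelSpace S] {C : Set S}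

/-- The joint Laplace transform of finitely many integrals against a point process. -/
lemma integral_exp_neg_map_integrals {Ω : Type v} [MeasurableSpace Ω] {P : Measure Ω}
    {N : Ω → NO C} (hC : IsClosed C) (hN : Measurable N) {ι : Type*} [Fintype ι]
    {g : ι → ↥Cᶜ → ℝ} (hg : ∀ i, IsTest (g i)) (t : ι → ℝ≥0) :
    ∫ x : ι → ℝ≥0, Real.exp (-∑ i, (t i : ℝ) * x i)
      ∂(P.map fun ω i => (∫ x, g i x ∂(N ω).toMeasure).toNNReal) =
    ∫ ω, Real.exp (-∫ x, ∑ i, (t i : ℝ) * g i x ∂(N ω).toMeasure) ∂P := by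
  rw [integral_map]
  · refine integral_congr_ae (ae_of_all _ fun ω => ?_)
    dsimp only
    rw [integral_finsetSum (μ := (N ω).toMeasure) _
      fun i _ => ((hg i).integrable (N ω).toMO).const_mul _]
    congr 2
    refine Finset.sum_congr rfl fun i _ => ?_
    rw [integral_const_mul, Real.coe_toNNReal _ (integral_nonneg (hg i).nonneg)]
  · exact (measurable_pi_lambda _ fun i =>
      ((NO.measurable_integral hC (hg i)).comp hN).real_toNNReal).aemeasurable
  · exact Continuous.aestronglyMeasurable (by fun_prop)

lemma NO.measurable_integrals (hC : IsClosed C) :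
    Measurable (NO.integrals : NO C → CO C → ℝ≥0) :=
  measurable_pi_lambda _ fun f =>
    (NO.measurable_integral hC (IsTest.of_mem_CO f.2)).real_toNNReal

/-- Point processes with the same Laplace functional have the same law. -/
theorem map_eq_of_laplace_eq (hC : IsClosed C) {Ω₁ : Type v} {Ω₂ : Type w} [MeasurableSpace Ω₁]
    [MeasurableSpace Ω₂] {P₁ : Measure Ω₁} {P₂ : Measure Ω₂} {N₁ : Ω₁ → NO C} {N₂ : Ω₂ → NO C}
    (h₁ : IsPointProcess P₁ N₁) (h₂ : IsPointProcess P₂ N₂)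
    (h : ∀ g : ↥Cᶜ → ℝ, IsTest g → ∫ ω, Real.exp (-∫ x, g x ∂(N₁ ω).toMeasure) ∂P₁ =
      ∫ ω, Real.exp (-∫ x, g x ∂(N₂ ω).toMeasure) ∂P₂) :
    P₁.map N₁ = P₂.map N₂ := by
  have := h₁.isProbabilityMeasure
  have := h₂.isProbabilityMeasure
  have hm := NO.measurable_integrals hC
  have hmap : (P₁.map N₁).map NO.integrals = (P₂.map N₂).map NO.integrals := by
    -- A finite measure on the product is determined by its finite-dimensional marginals, and these
    -- by their Laplace transforms.
    refine IsProjectiveLimit.unique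
      (P := fun I => ((P₂.map N₂).map NO.integrals).map I.restrict) (fun I => ?_) fun I => rfl
    have hI : Measurable (I.restrict : (CO C → ℝ≥0) → _) := Finset.measurable_restrict I
    dsimp only
    rw [Measure.map_map hI hm, Measure.map_map hI hm, Measure.map_map (hI.comp hm) h₁.measurable,
      Measure.map_map (hI.comp hm) h₂.measurable]
    have hg : ∀ i : I, IsTest (fun x => i.1.1 x) := fun i => IsTest.of_mem_CO i.1.2
    refine ext_of_laplaceTransform_eq fun t => ?_
    refine (integral_exp_neg_map_integrals hC h₁.measurable hg t).trans (Eq.trans ?_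
      (integral_exp_neg_map_integrals hC h₂.measurable hg t).symm)
    exact h _ (IsTest.sum _ fun i => (hg i).const_mul (t i).2)
  ext s hs
  obtain ⟨B, hB, rfl⟩ := NO.exists_preimage_integrals hs
  rw [← Measure.map_apply hm hB, ← Measure.map_apply hm hB, hmap]

end Law

/-! ### The Laplace functional of a PRM. -/

section PoissonLaplace

variable {S : Type u} [MetricSpace S] [MeasurableSpace S] [BorelSpace S] {C : Set S}
  {Ω : Type v} [MeasurableSpace Ω]

/-- The number of points of a counting measure in a set. -/
noncomputable def NO.count (ν : NO C) (A : Set ↥Cᶜ) : ℕ := ⌊(ν.toMeasure A).toReal⌋₊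

lemma NO.measure_eq_count (hC : IsClosed C) (ν : NO C) {A : Set ↥Cᶜ} (hA : MeasurableSet A)
    (hb : BoundedAway C A) : ν.toMeasure A = ν.count A := by
  obtain ⟨n, hn⟩ := ν.exists_nat hC hA hb
  simp [NO.count, hn]

lemma NO.measurable_count (hC : IsClosed C) {A : Set ↥Cᶜ} (hA : MeasurableSet A) :
    Measurable fun ν : NO C => ν.count A :=
  Nat.measurable_floor.comp (NO.measurable_coe hC hA).ennreal_toReal

lemma IsPRM.map_count {μ : MO C} {P : Measure Ω} {N : Ω → NO C} (hC : IsClosed C)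
    (h : IsPRM μ P N) {A : Set ↥Cᶜ} (hA : MeasurableSet A) (hb : BoundedAway C A) :
    P.map (fun ω => (N ω).count A) = poissonMeasure (μ.toMeasure A).toNNReal := by
  have hm : Measurable fun ω => (N ω).count A :=
    (NO.measurable_count hC hA).comp h.1.measurable
  refine Measure.ext_of_singleton fun k => ?_
  rw [Measure.map_apply hm (measurableSet_singleton k), poissonMeasure_singleton]
  convert h.poisson_of_lt_top A hA k (μ.measure_lt_top_of_boundedAway hb) using 2
  · ext ω
    simp [(N ω).measure_eq_count hC hA hb]
  · rfl

lemma IsPRM.integral_exp_neg_count {μ : MO C} {P : Measure Ω} {N : Ω → NO C} (hC : IsClosed C)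
    (h : IsPRM μ P N) {A : Set ↥Cᶜ} (hA : MeasurableSet A) (hb : BoundedAway C A) (c : ℝ) :
    ∫ ω, Real.exp (-(c * ((N ω).toMeasure A).toReal)) ∂P =
      Real.exp (-((μ.toMeasure A).toReal * (1 - Real.exp (-c)))) := by
  have hm : Measurable fun ω => (N ω).count A :=
    (NO.measurable_count hC hA).comp h.1.measurable
  have : ∀ ω, Real.exp (-(c * ((N ω).toMeasure A).toReal)) = Real.exp (-c) ^ (N ω).count A := by
    intro ω
    rw [(N ω).measure_eq_count hC hA hb, ENNReal.toReal_natCast, ← Real.exp_nat_mul]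
    ring_nf
  simp_rw [this]
  have := integral_pow_poissonMeasure (μ.toMeasure A).toNNReal (Real.exp (-c))
  rw [← h.map_count hC hA hb, integral_map hm.aemeasurable .of_discrete] at this
  exact this

/-- Independence factors the expectation; each factor is the Poisson generating function at e^(-c).
-/
lemma IsPRM.laplace_of_disjoint {μ : MO C} {P : Measure Ω} {N : Ω → NO C} (hC : IsClosed C)
    (h : IsPRM μ P N) {k : ℕ} {A : Fin k → Set ↥Cᶜ} (hA : ∀ i, MeasurableSet (A i))
    (hb : ∀ i, BoundedAway C (A i)) (hd : Pairwise fun i j => Disjoint (A i) (A j))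
    (c : Fin k → ℝ) :
    ∫ ω, Real.exp (-∑ i, c i * ((N ω).toMeasure (A i)).toReal) ∂P =
      Real.exp (-∑ i, (μ.toMeasure (A i)).toReal * (1 - Real.exp (-c i))) := by
  have := h.1.isProbabilityMeasure
  have hindep : iIndepFun (fun i ω => (N ω).toMeasure (A i)) P := by
    rcases Nat.eq_zero_or_pos k with rfl | hk
    · exact iIndepFun.of_subsingleton
    · exact h.indep k A hk hA hb hd
  simp_rw [← Finset.sum_neg_distrib, Real.exp_sum]
  rw [hindep.integral_fun_prod_comp (f := fun i y => Real.exp (-(c i * y.toReal)))]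
  · exact Finset.prod_congr rfl fun i _ => h.integral_exp_neg_count hC (hA i) (hb i) (c i)
  · exact fun i => ((NO.measurable_coe hC (hA i)).comp h.1.measurable).aemeasurable
  · intro i
    exact Measurable.aestronglyMeasurable (by fun_prop)

lemma IsPRM.laplace_simpleFunc {μ : MO C} {P : Measure Ω} {N : Ω → NO C} (hC : IsClosed C)
    (h : IsPRM μ P N) (s : SimpleFunc ↥Cᶜ ℝ) (hs : IsTest s) :
    ∫ ω, Real.exp (-∫ x, s x ∂(N ω).toMeasure) ∂P =
      Real.exp (-∫ x, (1 - Real.exp (-s x)) ∂μ.toMeasure) := by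
  classical
  -- The value 0 is dropped because its level set may reach `C`; the other level sets are bounded
  -- away from `C`.
  let J := s.range.filter (· ≠ 0)
  let e : Fin J.card ≃ J := J.equivFin.symm
  let A : Fin J.card → Set ↥Cᶜ := fun i => s ⁻¹' {(e i : ℝ)}
  have hne : ∀ i, (e i : ℝ) ≠ 0 := fun i => (Finset.mem_filter.1 (e i).2).2
  have hA : ∀ i, MeasurableSet (A i) := fun i => s.measurableSet_preimage _
  have hb : ∀ i, BoundedAway C (A i) := by
    intro i
    obtain ⟨r, hr, hv⟩ := hs.vanish
    refine ⟨r, hr, fun x hx => ?_⟩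
    by_contra hx'
    exact hne i (((Set.mem_singleton_iff.1 hx).symm).trans (hv x fun h => h hx'))
  have hd : Pairwise fun i j => Disjoint (A i) (A j) := by
    intro i j hij
    refine Set.disjoint_left.2 fun x hx hx' => hij (e.injective (Subtype.ext ?_))
    exact (Set.mem_singleton_iff.1 hx).symm.trans (Set.mem_singleton_iff.1 hx')
  -- Used for both F(y) = y and F(y) = 1 - e^(-y); F 0 = 0 compensates for the omitted level set.
  have hsum : ∀ F : ℝ → ℝ, F 0 = 0 → ∀ x,
      F (s x) = ∑ i, F (e i) * (A i).indicator (fun _ => (1 : ℝ)) x := by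
    intro F hF x
    by_cases hx : s x = 0
    · rw [hx, hF]
      refine (Finset.sum_eq_zero fun i _ => ?_).symm
      rw [Set.indicator_of_notMem, mul_zero]
      exact fun h => hne i ((Set.mem_singleton_iff.1 h).symm.trans hx)
    · have hJ : s x ∈ J := Finset.mem_filter.2 ⟨s.mem_range_self x, hx⟩
      rw [Finset.sum_eq_single (e.symm ⟨s x, hJ⟩)]
      · rw [Set.indicator_of_mem]
        · simp
        · simp [A]
      · intro i _ hi
        rw [Set.indicator_of_notMem, mul_zero]
        intro h
        refine hi ((e.symm_apply_eq.2 (Subtype.ext ?_)).symm)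
        exact Set.mem_singleton_iff.1 h
      · simp
  have hint : ∀ (ν : MO C) (F : ℝ → ℝ), F 0 = 0 →
      ∫ x, F (s x) ∂ν.toMeasure = ∑ i, F (e i) * (ν.toMeasure (A i)).toReal := by
    intro ν F hF
    simp_rw [hsum F hF]
    rw [integral_finsetSum _ fun i _ =>
      ((IsTest.indicator_one (hA i) (hb i)).integrable ν).const_mul _]
    refine Finset.sum_congr rfl fun i _ => ?_
    rw [integral_const_mul, integral_indicator_const _ (hA i), smul_eq_mul, mul_one]
    rfl
  rw [hint μ (fun y => 1 - Real.exp (-y)) (by simp)]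
  have := h.laplace_of_disjoint hC hA hb hd fun i => e i
  simp_rw [mul_comm (1 - Real.exp _)]
  rw [← this]
  refine integral_congr_ae (ae_of_all _ fun ω => ?_)
  exact congrArg (fun y => Real.exp (-y)) (hint (N ω).toMO (fun y => y) rfl)

/-- The Laplace functional of a Poisson random measure. -/
theorem IsPRM.laplace_eq {μ : MO C} {P : Measure Ω} {N : Ω → NO C} (hC : IsClosed C)
    (h : IsPRM μ P N) {g : ↥Cᶜ → ℝ} (hg : IsTest g) :
    ∫ ω, Real.exp (-∫ x, g x ∂(N ω).toMeasure) ∂P =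
      Real.exp (-∫ x, (1 - Real.exp (-g x)) ∂μ.toMeasure) := by
  have := h.1.isProbabilityMeasure
  have hgm : Measurable fun x => ENNReal.ofReal (g x) := hg.measurable.ennreal_ofReal
  let s : ℕ → SimpleFunc ↥Cᶜ ℝ := fun n =>
    (SimpleFunc.eapprox (fun x => ENNReal.ofReal (g x)) n).map ENNReal.toReal
  have hle : ∀ n x, s n x ≤ g x := fun n x => by
    refine (ENNReal.toReal_mono ENNReal.ofReal_ne_top ?_).trans
      (ENNReal.toReal_ofReal (hg.nonneg x)).le
    rw [← SimpleFunc.iSup_eapprox_apply hgm x]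
    exact le_iSup (fun n => SimpleFunc.eapprox (fun x => ENNReal.ofReal (g x)) n x) n
  have h0 : ∀ n x, 0 ≤ s n x := fun n x => ENNReal.toReal_nonneg
  have hlim : ∀ x, Tendsto (fun n => s n x) atTop (𝓝 (g x)) := fun x => by
    have := (ENNReal.tendsto_toReal ENNReal.ofReal_ne_top).comp
      (SimpleFunc.tendsto_eapprox hgm x)
    rwa [ENNReal.toReal_ofReal (hg.nonneg x)] at this
  have htest : ∀ n, IsTest (s n) := fun n => hg.of_le (s n).measurable (h0 n) (hle n)
  -- Dominated convergence twice: inside with majorant g, outside with majorant 1.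
  have hL : Tendsto (fun n => ∫ ω, Real.exp (-∫ x, s n x ∂(N ω).toMeasure) ∂P) atTop
      (𝓝 (∫ ω, Real.exp (-∫ x, g x ∂(N ω).toMeasure) ∂P)) := by
    refine tendsto_integral_of_dominated_convergence (fun _ => 1) (fun n => ?_)
      (integrable_const _) (fun n => ae_of_all _ fun ω => ?_) (ae_of_all _ fun ω => ?_)
    · exact (((NO.measurable_integral hC (htest n)).comp
        h.1.measurable).neg.exp).aestronglyMeasurable
    · rw [Real.norm_eq_abs, Real.abs_exp, Real.exp_le_one_iff, neg_nonpos]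
      exact integral_nonneg (h0 n)
    · refine (Real.continuous_exp.tendsto _).comp (Tendsto.neg ?_)
      refine tendsto_integral_of_dominated_convergence g
        (fun n => (s n).measurable.aestronglyMeasurable) (hg.integrable (N ω).toMO)
        (fun n => ae_of_all _ fun x => ?_) (ae_of_all _ hlim)
      rw [Real.norm_of_nonneg (h0 n x)]
      exact hle n x
  have hR : Tendsto (fun n => Real.exp (-∫ x, (1 - Real.exp (-s n x)) ∂μ.toMeasure)) atTop
      (𝓝 (Real.exp (-∫ x, (1 - Real.exp (-g x)) ∂μ.toMeasure))) := by
    refine (Real.continuous_exp.tendsto _).comp (Tendsto.neg ?_)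
    refine tendsto_integral_of_dominated_convergence g
      (fun n => (htest n).one_sub_exp_neg.measurable.aestronglyMeasurable) (hg.integrable μ)
      (fun n => ae_of_all _ fun x => ?_) (ae_of_all _ fun x => ?_)
    · rw [Real.norm_of_nonneg ((htest n).one_sub_exp_neg.nonneg x)]
      have := Real.add_one_le_exp (-s n x)
      linarith [hle n x]
    · exact ((Real.continuous_exp.tendsto _).comp (hlim x).neg).const_sub 1
  refine tendsto_nhds_unique hL (hR.congr fun n => ?_)
  exact (h.laplace_simpleFunc hC (s n) (htest n)).symm

end PoissonLaplace

/-! ### The converse: from the Laplace functional to Poisson counts. -/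

section Indicator

variable {S : Type u} [MetricSpace S] [MeasurableSpace S] {C : Set S}

lemma NO.coe_toNNReal_integral_indicator (ν : NO C) {A : Set ↥Cᶜ} (hA : MeasurableSet A)
    (hb : BoundedAway C A) :
    ((∫ x, A.indicator (fun _ => (1 : ℝ)) x ∂ν.toMeasure).toNNReal : ℝ≥0∞) = ν.toMeasure A := by
  rw [integral_indicator_const _ hA, smul_eq_mul, mul_one]
  exact ENNReal.ofReal_toReal (ν.toMO.measure_lt_top_of_boundedAway hb).ne

/-- By disjointness at most one indicator is nonzero at x. This linearity makes the Laplace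
transform of the counts factor. -/
lemma one_sub_exp_neg_sum_indicator {α ι : Type*} [Fintype ι] {A : ι → Set α}
    (hd : Pairwise fun i j => Disjoint (A i) (A j)) (t : ι → ℝ) (x : α) :
    1 - Real.exp (-∑ i, t i * (A i).indicator (fun _ => (1 : ℝ)) x) =
      ∑ i, (1 - Real.exp (-t i)) * (A i).indicator (fun _ => (1 : ℝ)) x := by
  classical
  by_cases hx : ∃ i, x ∈ A i
  · obtain ⟨i, hi⟩ := hx
    have hne : ∀ j, j ≠ i → (A j).indicator (fun _ => (1 : ℝ)) x = 0 := fun j hj =>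
      Set.indicator_of_notMem (fun h => Set.disjoint_left.1 (hd hj) h hi) _
    rw [Finset.sum_eq_single i (fun j _ hj => by rw [hne j hj, mul_zero]) (by simp),
      Finset.sum_eq_single i (fun j _ hj => by rw [hne j hj, mul_zero]) (by simp),
      Set.indicator_of_mem hi, mul_one, mul_one]
  · push Not at hx
    simp [Set.indicator_of_notMem (hx _)]

end Indicator

section Converse

variable {S : Type u} [MetricSpace S] [MeasurableSpace S] [BorelSpace S] {C : Set S}
  {Ω : Type v} [MeasurableSpace Ω]

/-- The joint law of the numbers of points in disjoint sets, from the Laplace functional. -/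
lemma map_integral_indicator_of_laplace (hC : IsClosed C) {μ : MO C} {P : Measure Ω}
    {N : Ω → NO C} (hN : IsPointProcess P N)
    (h : ∀ g : ↥Cᶜ → ℝ, IsTest g → ∫ ω, Real.exp (-∫ x, g x ∂(N ω).toMeasure) ∂P =
      Real.exp (-∫ x, (1 - Real.exp (-g x)) ∂μ.toMeasure))
    {ι : Type*} [Fintype ι] {A : ι → Set ↥Cᶜ} (hA : ∀ i, MeasurableSet (A i))
    (hb : ∀ i, BoundedAway C (A i)) (hd : Pairwise fun i j => Disjoint (A i) (A j)) :
    P.map (fun ω i => (∫ x, (A i).indicator (fun _ => (1 : ℝ)) x ∂(N ω).toMeasure).toNNReal) =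
      Measure.pi fun i =>
        (poissonMeasure (μ.toMeasure (A i)).toNNReal).map (Nat.cast : ℕ → ℝ≥0) := by
  have := hN.isProbabilityMeasure
  have hg : ∀ i, IsTest ((A i).indicator fun _ => (1 : ℝ)) :=
    fun i => IsTest.indicator_one (hA i) (hb i)
  refine ext_of_laplaceTransform_eq fun t => ?_
  rw [integral_exp_neg_map_integrals hC hN.measurable hg t,
    h _ (IsTest.sum Finset.univ fun i => (hg i).const_mul (NNReal.coe_nonneg (t i)))]
  simp_rw [one_sub_exp_neg_sum_indicator hd]
  rw [integral_finsetSum _ fun i _ => ((hg i).integrable μ).const_mul _]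
  simp_rw [← Finset.sum_neg_distrib, Real.exp_sum]
  rw [integral_fintype_prod_eq_prod (f := fun i (y : ℝ≥0) => Real.exp (-((t i : ℝ) * y)))]
  refine Finset.prod_congr rfl fun i _ => ?_
  rw [integral_const_mul, integral_indicator_const _ (hA i), smul_eq_mul, mul_one,
    integral_map .of_discrete (Continuous.aestronglyMeasurable (by fun_prop)), mul_comm]
  have : ∀ n : ℕ, Real.exp (-((t i : ℝ) * ((n : ℝ≥0) : ℝ))) = Real.exp (-(t i : ℝ)) ^ n := by
    intro n
    rw [← Real.exp_nat_mul, NNReal.coe_natCast]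
    ring_nf
  simp_rw [this]
  exact (integral_pow_poissonMeasure _ _).symm

lemma measure_eq_of_laplace (hC : IsClosed C) {μ : MO C} {P : Measure Ω}
    {N : Ω → NO C} (hN : IsPointProcess P N)
    (h : ∀ g : ↥Cᶜ → ℝ, IsTest g → ∫ ω, Real.exp (-∫ x, g x ∂(N ω).toMeasure) ∂P =
      Real.exp (-∫ x, (1 - Real.exp (-g x)) ∂μ.toMeasure))
    {A : Set ↥Cᶜ} (hA : MeasurableSet A) (hb : BoundedAway C A) (k : ℕ) :
    P {ω | (N ω).toMeasure A = k} =
      ENNReal.ofReal (Real.exp (-(μ.toMeasure A).toReal) * (μ.toMeasure A).toReal ^ k /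
        (Nat.factorial k : ℝ)) := by
  have hmap := map_integral_indicator_of_laplace hC hN h (ι := Unit) (A := fun _ => A)
    (fun _ => hA) (fun _ => hb) (fun i j hij => (hij rfl).elim)
  have hmeas : Measurable fun ω (_ : Unit) =>
      (∫ x, A.indicator (fun _ => (1 : ℝ)) x ∂(N ω).toMeasure).toNNReal :=
    measurable_pi_lambda _ fun _ => ((NO.measurable_integral hC
      (IsTest.indicator_one hA hb)).comp hN.measurable).real_toNNReal
  have hset : {ω | (N ω).toMeasure A = k} = (fun ω (_ : Unit) =>
      (∫ x, A.indicator (fun _ => (1 : ℝ)) x ∂(N ω).toMeasure).toNNReal) ⁻¹'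
        (Set.univ.pi fun _ => {(k : ℝ≥0)}) := by
    ext ω
    simp only [Set.mem_ofPred_eq, Set.mem_preimage, Set.mem_univ_pi, Set.mem_singleton_iff,
      forall_const]
    rw [← (N ω).coe_toNNReal_integral_indicator hA hb, ← ENNReal.coe_natCast, ENNReal.coe_inj]
  rw [hset, ← Measure.map_apply hmeas (MeasurableSet.univ_pi fun _ => measurableSet_singleton _),
    hmap, Measure.pi_pi]
  simp only [Finset.univ_unique, Finset.prod_singleton]
  rw [Measure.map_apply .of_discrete (measurableSet_singleton _)]
  have : (Nat.cast : ℕ → ℝ≥0) ⁻¹' {(k : ℝ≥0)} = {k} := by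
    ext n; simp
  rw [this, poissonMeasure_singleton]
  rfl

/-- A sequence of natural numbers in `ℝ≥0∞` is eventually equal to `k` iff its limit is `k`. -/
lemma eventually_eq_natCast_iff {a : ℕ → ℝ≥0∞} {l : ℝ≥0∞} (ha : ∀ n, ∃ m : ℕ, a n = m)
    (hl : Tendsto a atTop (𝓝 l)) (k : ℕ) : ∀ᶠ n in atTop, (a n = k ↔ l = k) := by
  by_cases h : l = k
  · have hlt : ∀ᶠ n in atTop, a n < (k : ℝ≥0∞) + 1 := hl.eventually_lt_const (by
      rw [h]; exact_mod_cast Nat.lt_succ_self k)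
    have hgt : ∀ᶠ n in atTop, (k : ℝ≥0∞) < a n + 1 := by
      refine (hl.add_const 1).eventually_const_lt ?_
      rw [h]; exact_mod_cast Nat.lt_succ_self k
    filter_upwards [hlt, hgt] with n h1 h2
    obtain ⟨m, hm⟩ := ha n
    rw [hm] at h1 h2 ⊢
    norm_cast at h1 h2
    simp only [h, iff_true]
    norm_cast
    omega
  · filter_upwards [hl.eventually_ne h] with n hn
    simp [hn, h]

theorem isPRM_of_laplace (hC : IsClosed C) {μ : MO C} {P : Measure Ω}
    {N : Ω → NO C} (hN : IsPointProcess P N)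
    (h : ∀ g : ↥Cᶜ → ℝ, IsTest g → ∫ ω, Real.exp (-∫ x, g x ∂(N ω).toMeasure) ∂P =
      Real.exp (-∫ x, (1 - Real.exp (-g x)) ∂μ.toMeasure)) : IsPRM μ P N := by
  have := hN.isProbabilityMeasure
  have hlim : ∀ (ν : Measure ↥Cᶜ) (A : Set ↥Cᶜ), Tendsto
      (fun n : ℕ => ν (A ∩ far C (1 / ((n : ℝ) + 1)))) atTop (𝓝 (ν A)) := by
    intro ν A
    have hmono : Monotone fun n : ℕ => A ∩ far C (1 / ((n : ℝ) + 1)) :=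
      fun m n h => Set.inter_subset_inter_right A (monotone_far_one_div h)
    have := tendsto_measure_iUnion_atTop (μ := ν) hmono
    rwa [← Set.inter_iUnion, iUnion_far hC, Set.inter_univ] at this
  have hbn : ∀ (A : Set ↥Cᶜ) (n : ℕ), BoundedAway C (A ∩ far C (1 / ((n : ℝ) + 1))) :=
    fun A n => ⟨_, Nat.one_div_pos_of_nat, fun x hx => hx.2⟩
  have hmn : ∀ {A : Set ↥Cᶜ} (_ : MeasurableSet A) (n : ℕ),
      MeasurableSet (A ∩ far C (1 / ((n : ℝ) + 1))) := fun hA n => hA.inter (measurableSet_far _)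
  have hP : ∀ {A : Set ↥Cᶜ} (_ : MeasurableSet A) (k : ℕ), Tendsto (fun n : ℕ =>
      ENNReal.ofReal (Real.exp (-(μ.toMeasure (A ∩ far C (1 / ((n : ℝ) + 1)))).toReal) *
        (μ.toMeasure (A ∩ far C (1 / ((n : ℝ) + 1)))).toReal ^ k / (Nat.factorial k : ℝ)))
      atTop (𝓝 (P {ω | (N ω).toMeasure A = k})) := by
    intro A hA k
    simp_rw [← fun n : ℕ => measure_eq_of_laplace hC hN h (hmn hA n) (hbn A n) k]
    refine tendsto_measure_of_tendsto_indicator_of_isFiniteMeasure _ P (fun n => ?_) fun ω => ?_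
    · exact ((NO.measurable_coe hC (hmn hA n)).comp hN.measurable) (measurableSet_singleton _)
    -- Counts on the truncated sets are integers, so whether they equal k is eventually decided by
    -- the limit; hence the indicators of the events converge pointwise.
    · exact eventually_eq_natCast_iff (fun n => (N ω).exists_nat hC (hmn hA n) (hbn A n))
        (hlim _ A) k
  refine ⟨hN, fun A hA k hfin => ?_, fun A hA k htop => ?_, fun k A _ hA hb hd => ?_⟩
  · refine tendsto_nhds_unique (hP hA k) ?_
    have ht := (ENNReal.tendsto_toReal hfin.ne).comp (hlim μ.toMeasure A)
    refine (ENNReal.continuous_ofReal.tendsto _).comp ?_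
    exact (((Real.continuous_exp.tendsto _).comp ht.neg).mul (ht.pow k)).div_const _
  · refine tendsto_nhds_unique (hP hA k) ?_
    have ht : Tendsto (fun n : ℕ => (μ.toMeasure (A ∩ far C (1 / ((n : ℝ) + 1)))).toReal)
        atTop atTop := by
      rw [← ENNReal.tendsto_ofReal_nhds_top]
      have := hlim μ.toMeasure A
      rw [htop] at this
      refine this.congr fun n => (ENNReal.ofReal_toReal ?_).symm
      exact (μ.measure_lt_top_of_boundedAway (hbn A n)).ne
    -- For infinite mean the Poisson weights vanish in the limit, since x^k e^(-x) → 0.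
    have := ((Real.tendsto_pow_mul_exp_neg_atTop_nhds_zero k).comp ht).div_const
      (Nat.factorial k : ℝ)
    rw [zero_div] at this
    have := (ENNReal.continuous_ofReal.tendsto _).comp this
    rw [ENNReal.ofReal_zero] at this
    refine this.congr fun n => ?_
    simp only [Function.comp_apply]
    rw [mul_comm]
  · have hmap := map_integral_indicator_of_laplace hC hN h hA hb hd
    have hX : ∀ i, Measurable fun ω =>
        (∫ x, (A i).indicator (fun _ => (1 : ℝ)) x ∂(N ω).toMeasure).toNNReal := fun i =>
      ((NO.measurable_integral hC (IsTest.indicator_one (hA i) (hb i))).comp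
        hN.measurable).real_toNNReal
    have hind : iIndepFun (fun i ω =>
        (∫ x, (A i).indicator (fun _ => (1 : ℝ)) x ∂(N ω).toMeasure).toNNReal) P := by
      refine (iIndepFun_iff_map_fun_eq_pi_map fun i => (hX i).aemeasurable).2 ?_
      rw [hmap]
      congr 1
      ext1 i
      -- Projecting the product law to one coordinate identifies its factor as the marginal, which
      -- gives independence.
      have := congrArg (Measure.map (Function.eval i)) hmap
      rw [Measure.map_map (measurable_pi_apply i) (measurable_pi_lambda _ hX),
        (measurePreserving_eval _ i).map_eq] at this
      exact this.symm
    convert hind.comp (fun _ => ((↑) : ℝ≥0 → ℝ≥0∞)) (fun _ => measurable_coe_nnreal_ennreal)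
      using 3 with i ω
    exact ((N ω).coe_toNNReal_integral_indicator (hA i) (hb i)).symm

end Converse

/-! ### Existence by superposing Poisson samples on annuli. -/

section Existence

/-- The sum of Dirac masses at the first `p.1` points of the sequence `p.2`. -/
noncomputable def sample {X : Type*} [MeasurableSpace X] (p : ℕ × (ℕ → X)) : Measure X :=
  ∑ i ∈ Finset.range p.1, Measure.dirac (p.2 i)

lemma exists_nat_sample {X : Type*} [MeasurableSpace X] (p : ℕ × (ℕ → X)) {B : Set X}
    (hB : MeasurableSet B) : ∃ n : ℕ, sample p B = n := by
  classical
  refine ⟨∑ i ∈ Finset.range p.1, if p.2 i ∈ B then 1 else 0, ?_⟩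
  simp [sample, Measure.dirac_apply' _ hB, Set.indicator_apply]

lemma measurable_sample {X : Type*} [MeasurableSpace X] :
    Measurable (sample : ℕ × (ℕ → X) → Measure X) := by
  refine measurable_from_prod_countable_right fun k => ?_
  refine Measure.measurable_of_measurable_coe _ fun B hB => ?_
  simp only [sample, Measure.coe_finsetSum, Finset.sum_apply]
  refine Finset.measurable_fun_sum _ fun i _ => ?_
  exact (Measure.measurable_coe hB).comp (Measure.measurable_dirac.comp (measurable_pi_apply i))

lemma setIntegral_sample {X : Type*} [MeasurableSpace X] (p : ℕ × (ℕ → X))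
    {D : Set X} (hD : MeasurableSet D) {g : X → ℝ} (hg : Measurable g) :
    ∫ x in D, g x ∂(sample p) = ∑ i ∈ Finset.range p.1, D.indicator g (p.2 i) := by
  have hm : StronglyMeasurable (D.indicator g) := (hg.indicator hD).stronglyMeasurable
  rw [← integral_indicator hD, sample, integral_finsetSum_measure]
  · simp [integral_dirac' _ _ hm]
  · intro i _
    exact integrable_dirac' hm (by simp)

lemma measurable_exp_neg_setIntegral_sample {X : Type*} [MeasurableSpace X]
    {D : Set X} (hD : MeasurableSet D) {g : X → ℝ} (hg : Measurable g) :
    Measurable fun p : ℕ × (ℕ → X) => Real.exp (-∫ x in D, g x ∂(sample p)) := by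
  simp_rw [setIntegral_sample _ hD hg]
  refine measurable_from_prod_countable_right fun k => ?_
  have : Measurable fun y : ℕ → X => ∑ i ∈ Finset.range k, D.indicator g (y i) :=
    Finset.measurable_fun_sum _ fun i _ => (hg.indicator hD).comp (measurable_pi_apply i)
  exact this.neg.exp

/-- The Laplace functional of a Poisson number of independent points with law `κ`. -/
lemma integral_exp_neg_sample {X : Type*} [MeasurableSpace X] (κ : Measure X)
    [IsProbabilityMeasure κ] (r : ℝ≥0) {D : Set X} (hD : MeasurableSet D) {g : X → ℝ}
    (hg : Measurable g) (h0 : ∀ x, 0 ≤ g x) :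
    ∫ p, Real.exp (-∫ x in D, g x ∂(sample p))
      ∂((poissonMeasure r).prod (Measure.infinitePi fun _ : ℕ => κ)) =
    Real.exp (-∫ x in D, (1 - Real.exp (-g x)) ∂(r • κ)) := by
  have hi0 : ∀ x, 0 ≤ D.indicator g x := fun x => Set.indicator_nonneg (fun x _ => h0 x) x
  have him : Measurable (D.indicator g) := hg.indicator hD
  have hbd : Integrable (fun x => Real.exp (-D.indicator g x)) κ := by
    refine Integrable.of_bound him.neg.exp.aestronglyMeasurable 1 (ae_of_all _ fun x => ?_)
    rw [Real.norm_eq_abs, Real.abs_exp, Real.exp_le_one_iff, neg_nonpos]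
    exact hi0 x
  rw [integral_prod]
  · have inner : ∀ k : ℕ, ∫ x : ℕ → X, Real.exp (-∫ y in D, g y ∂(sample (k, x)))
        ∂(Measure.infinitePi fun _ : ℕ => κ) = (∫ x, Real.exp (-D.indicator g x) ∂κ) ^ k := by
      intro k
      simp_rw [setIntegral_sample _ hD hg, ← Finset.sum_neg_distrib, Real.exp_sum]
      -- Given the number k of points, only the first k coordinates matter, and the expectation is a
      -- k-th power.
      have := integral_restrict_infinitePi (μ := fun _ : ℕ => κ) (s := Finset.range k)
        (f := fun y => ∏ i, Real.exp (-D.indicator g (y i)))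
        (Measurable.aestronglyMeasurable (by fun_prop))
      rw [integral_fintype_prod_eq_pow (fun x => Real.exp (-D.indicator g x)),
        Fintype.card_coe, Finset.card_range] at this
      rw [← this]
      refine integral_congr_ae (ae_of_all _ fun y => ?_)
      exact (Finset.prod_coe_sort (Finset.range k) fun i => Real.exp (-D.indicator g (y i))).symm
    simp_rw [inner]
    rw [integral_pow_poissonMeasure]
    congr 2
    have h1 : ∫ x in D, (1 - Real.exp (-g x)) ∂κ = ∫ x, (1 - Real.exp (-D.indicator g x)) ∂κ := by
      rw [← integral_indicator hD]
      refine integral_congr_ae (ae_of_all _ fun x => ?_)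
      by_cases hx : x ∈ D <;> simp [hx]
    rw [Measure.restrict_smul, integral_smul_nnreal_measure, h1, integral_sub (integrable_const _) hbd]
    simp [NNReal.smul_def]
  · refine Integrable.of_bound
      (measurable_exp_neg_setIntegral_sample hD hg).aestronglyMeasurable 1
      (ae_of_all _ fun p => ?_)
    rw [Real.norm_eq_abs, Real.abs_exp, Real.exp_le_one_iff, neg_nonpos]
    exact integral_nonneg h0

/-- `Nonempty X` covers κ = 0, where r = 0 and some probability measure must still exist. -/
lemma exists_smul_isProbabilityMeasure {X : Type*} [MeasurableSpace X] [Nonempty X]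
    (κ : Measure X) [IsFiniteMeasure κ] :
    ∃ (r : ℝ≥0) (ρ : Measure X), IsProbabilityMeasure ρ ∧ κ = r • ρ := by
  exact ⟨_, _, ProbabilityMeasure.instIsProbabilityMeasureToMeasure _, congrArg Subtype.val
    (FiniteMeasure.self_eq_mass_smul_normalize (⟨κ, inferInstance⟩ : FiniteMeasure X))⟩

variable {S : Type u} [MetricSpace S] {C : Set S}

/-- The annuli `C^(1/n) ∖ C^(1/(n+1))`, with the complement of `C^1` for `n = 0`. -/
def annulus (C : Set S) (n : ℕ) : Set ↥Cᶜ := disjointed (fun n : ℕ => far C (1 / ((n : ℝ) + 1))) n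

lemma annulus_subset (n : ℕ) : annulus C n ⊆ far C (1 / ((n : ℝ) + 1)) := disjointed_subset _ n

lemma iUnion_annulus (hC : IsClosed C) : ⋃ n, annulus C n = Set.univ := by
  rw [← iUnion_far hC]
  exact iUnion_disjointed

lemma pairwise_disjoint_annulus : Pairwise fun m n => Disjoint (annulus C m) (annulus C n) :=
  disjoint_disjointed _

/-- Only finitely many annuli meet `S ∖ C^r`. -/
lemma exists_disjoint_annulus {r : ℝ} (hr : 0 < r) :
    ∃ m : ℕ, ∀ n, m ≤ n → Disjoint (far C r) (annulus C n) := by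
  obtain ⟨m, hm⟩ := exists_nat_one_div_lt hr
  -- The far set with index m contains `far C r` and is removed only from annuli of index greater
  -- than m.
  refine ⟨m + 1, fun n hn => ?_⟩
  refine Disjoint.mono_left (far_anti hm.le) ?_
  rw [annulus, disjointed_apply]
  exact disjoint_sdiff_self_right.mono_left
    (Finset.le_sup (f := fun n : ℕ => far C (1 / ((n : ℝ) + 1))) (Finset.mem_Iio.2 hn))

variable [MeasurableSpace S]

/-- Integrals against a sum of measures living on the annuli reduce to finite sums. -/
lemma exists_integral_sum_annulus {r : ℝ} (hr : 0 < r) : ∃ m : ℕ, ∀ (κ : ℕ → Measure ↥Cᶜ)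
    (g : ↥Cᶜ → ℝ), (∀ x, x ∉ far C r → g x = 0) →
    Integrable g (Measure.sum fun n => (κ n).restrict (annulus C n)) →
    ∫ x, g x ∂(Measure.sum fun n => (κ n).restrict (annulus C n)) =
      ∑ n ∈ Finset.range m, ∫ x in annulus C n, g x ∂(κ n) := by
  obtain ⟨m, hm⟩ := exists_disjoint_annulus (C := C) hr
  refine ⟨m, fun κ g hv hg => ?_⟩
  rw [integral_sum_measure hg, tsum_eq_sum]
  intro n hn
  refine setIntegral_eq_zero_of_forall_eq_zero fun x hx => hv x fun hx' => ?_
  exact Set.disjoint_left.1 (hm n (not_lt.1 fun h => hn (Finset.mem_range.2 h))) hx' hx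

variable [BorelSpace S]

lemma measurableSet_annulus (n : ℕ) : MeasurableSet (annulus C n) :=
  MeasurableSet.disjointed (fun _ => measurableSet_far _) n

/-- The superposition of samples, each restricted to its annulus. -/
noncomputable def superposition (ω : ℕ → ℕ × (ℕ → ↥Cᶜ)) : Measure ↥Cᶜ :=
  Measure.sum fun n => (sample (ω n)).restrict (annulus C n)

/-- Restricting each sample to its annulus leaves finitely many terms on `B` for every ω, not merely
almost surely, so the superposition always lies in `NO C`. -/
lemma exists_nat_superposition (ω : ℕ → ℕ × (ℕ → ↥Cᶜ)) {r : ℝ} (hr : 0 < r) {B : Set ↥Cᶜ}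
    (hB : MeasurableSet B) (hBr : B ⊆ far C r) : ∃ n : ℕ, superposition ω B = n := by
  obtain ⟨m, hm⟩ := exists_disjoint_annulus (C := C) hr
  choose k hk using fun n => exists_nat_sample (ω n) (hB.inter (measurableSet_annulus (C := C) n))
  refine ⟨∑ n ∈ Finset.range m, k n, ?_⟩
  rw [superposition, Measure.sum_apply _ hB, tsum_eq_sum (s := Finset.range m)]
  · simp [Measure.restrict_apply hB, hk]
  · intro n hn
    rw [Measure.restrict_apply hB, Set.disjoint_iff_inter_eq_empty.1, measure_empty]
    exact (hm n (not_lt.1 fun h => hn (Finset.mem_range.2 h))).mono_left hBr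

lemma measurable_superposition :
    Measurable (superposition : (ℕ → ℕ × (ℕ → ↥Cᶜ)) → Measure ↥Cᶜ) := by
  refine Measure.measurable_of_measurable_coe _ fun B hB => ?_
  simp only [superposition, Measure.sum_apply _ hB, Measure.restrict_apply hB]
  refine Measurable.tsum fun n => ?_
  exact (Measure.measurable_coe (hB.inter (measurableSet_annulus n))).comp
    (measurable_sample.comp (measurable_pi_apply n))

/-- The superposition of samples as a counting measure. -/
noncomputable def superpositionNO (ω : ℕ → ℕ × (ℕ → ↥Cᶜ)) : NO C :=
  ⟨⟨superposition ω, fun r hr => by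
    obtain ⟨n, hn⟩ := exists_nat_superposition ω hr (measurableSet_far r) subset_rfl
    exact (hn.trans_lt (ENNReal.natCast_lt_top n))⟩, fun r hr A hA => by
    refine exists_nat_superposition ω hr ?_ fun x hx => hx.2
    exact (hA.diff Metric.isOpen_thickening.measurableSet).preimage measurable_subtype_coe⟩

lemma measurable_superpositionNO :
    Measurable (superpositionNO : (ℕ → ℕ × (ℕ → ↥Cᶜ)) → NO C) := by
  refine measurable_comap_iff.2 (MO.measurable_of_integral fun f hf => ?_)
  have : ∀ ω : ℕ → ℕ × (ℕ → ↥Cᶜ), ∫ x, f x ∂(superposition ω) =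
      (∫⁻ x, ENNReal.ofReal (f x) ∂(superposition ω)).toReal := fun ω =>
    integral_eq_lintegral_of_nonneg_ae (ae_of_all _ hf.1)
      f.continuous.measurable.aestronglyMeasurable
  change Measurable fun ω => ∫ x, f x ∂(superposition ω)
  simp_rw [this]
  exact ((Measure.measurable_lintegral f.continuous.measurable.ennreal_ofReal).comp
    measurable_superposition).ennreal_toReal

theorem exists_isPRM (hC : IsClosed C) (μ : MO C) :
    ∃ (Ω : Type u) (_ : MeasurableSpace Ω) (P : Measure Ω) (N : Ω → NO C), IsPRM μ P N := by
  -- An empty 𝕆 carries no probability measure to sample from; the zero process serves there.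
  rcases isEmpty_or_nonempty ↥Cᶜ with hE | hE
  · refine ⟨PUnit, inferInstance, Measure.dirac PUnit.unit, fun _ => ⟨MO.zero C, fun r hr A hA =>
      ⟨0, by simp [MO.zero, MO.toMeasure]⟩⟩, isPRM_of_laplace hC ⟨inferInstance, measurable_const⟩
        fun g hg => ?_⟩
    simp [Measure.eq_zero_of_isEmpty]
  have hfin : ∀ n, IsFiniteMeasure (μ.toMeasure.restrict (annulus C n)) := fun n =>
    ⟨by
      rw [Measure.restrict_apply_univ]
      exact (measure_mono (annulus_subset n)).trans_lt
        (μ.measure_far_lt_top Nat.one_div_pos_of_nat)⟩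
  choose m κ hκ hμκ using fun n =>
    exists_smul_isProbabilityMeasure (μ.toMeasure.restrict (annulus C n))
  let P := Measure.infinitePi fun n : ℕ =>
    (poissonMeasure (m n)).prod (Measure.infinitePi fun _ : ℕ => κ n)
  refine ⟨ℕ → ℕ × (ℕ → ↥Cᶜ), inferInstance, P, superpositionNO, isPRM_of_laplace hC
    ⟨inferInstance, measurable_superpositionNO⟩ fun g hg => ?_⟩
  obtain ⟨r, hr, hv⟩ := hg.vanish
  -- `M` depends only on r, so the same finite truncation applies to μ and to every realization.
  obtain ⟨M, hM⟩ := exists_integral_sum_annulus (C := C) hr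
  have hμ : (Measure.sum fun n => μ.toMeasure.restrict (annulus C n)) = μ.toMeasure := by
    rw [← Measure.restrict_iUnion pairwise_disjoint_annulus measurableSet_annulus,
      iUnion_annulus hC, Measure.restrict_univ]
  have hright := hM (fun _ => μ.toMeasure) (fun x => 1 - Real.exp (-g x))
    (fun x hx => by simp [hv x hx]) (by rw [hμ]; exact hg.one_sub_exp_neg.integrable μ)
  rw [hμ] at hright
  have hleft : ∀ ω : ℕ → ℕ × (ℕ → ↥Cᶜ), ∫ x, g x ∂(superpositionNO ω).toMeasure =
      ∑ n ∈ Finset.range M, ∫ x in annulus C n, g x ∂(sample (ω n)) := fun ω =>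
    hM (fun n => sample (ω n)) g hv (hg.integrable (superpositionNO ω).toMO)
  simp_rw [hleft, hright, ← Finset.sum_neg_distrib, Real.exp_sum]
  have hF : ∀ n, Measurable fun p : ℕ × (ℕ → ↥Cᶜ) =>
      Real.exp (-∫ x in annulus C n, g x ∂(sample p)) := fun n =>
    measurable_exp_neg_setIntegral_sample (measurableSet_annulus n) hg.measurable
  have hres := integral_restrict_infinitePi (μ := fun n : ℕ =>
      (poissonMeasure (m n)).prod (Measure.infinitePi fun _ : ℕ => κ n)) (s := Finset.range M)
    (f := fun y => ∏ n, Real.exp (-∫ x in annulus C n, g x ∂(sample (y n))))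
    (Finset.measurable_fun_prod Finset.univ fun (n : Finset.range M) _ =>
      (hF n).comp (measurable_pi_apply n)).aestronglyMeasurable
  rw [integral_fintype_prod_eq_prod (f := fun (n : Finset.range M) p =>
    Real.exp (-∫ x in annulus C n, g x ∂(sample p)))] at hres
  calc ∫ ω, ∏ n ∈ Finset.range M, Real.exp (-∫ x in annulus C n, g x ∂(sample (ω n))) ∂P
      = ∏ n : Finset.range M, ∫ p, Real.exp (-∫ x in annulus C n, g x ∂(sample p))
          ∂((poissonMeasure (m n)).prod (Measure.infinitePi fun _ : ℕ => κ n)) := by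
        rw [← hres]
        refine integral_congr_ae (ae_of_all _ fun ω => ?_)
        exact (Finset.prod_coe_sort (Finset.range M) fun n =>
          Real.exp (-∫ x in annulus C n, g x ∂(sample (ω n)))).symm
    _ = ∏ n : Finset.range M,
          Real.exp (-∫ x in annulus C n, (1 - Real.exp (-g x)) ∂μ.toMeasure) := by
        refine Finset.prod_congr rfl fun n _ => ?_
        rw [integral_exp_neg_sample _ _ (measurableSet_annulus _) hg.measurable hg.nonneg,
          ← hμκ, Measure.restrict_restrict (measurableSet_annulus _), Set.inter_self]
    _ = ∏ n ∈ Finset.range M,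
          Real.exp (-∫ x in annulus C n, (1 - Real.exp (-g x)) ∂μ.toMeasure) :=
        Finset.prod_coe_sort (Finset.range M) fun n =>
          Real.exp (-∫ x in annulus C n, (1 - Real.exp (-g x)) ∂μ.toMeasure)

end Existence

end PRM

theorem proposition4p2 {S : Type u} [MetricSpace S] [CompleteSpace S]
    [TopologicalSpace.SeparableSpace S] [MeasurableSpace S] [BorelSpace S]
    (C : Set S) (hC : IsClosed C) (μ : PRM.MO C) :
    -- existence
    (∃ (Ω : Type u) (_ : MeasurableSpace Ω) (P : Measure Ω) (N : Ω → PRM.NO C),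
      PRM.IsPRM μ P N) ∧
    -- uniqueness of the law
    (∀ (Ω₁ : Type v) (_ : MeasurableSpace Ω₁) (P₁ : Measure Ω₁) (N₁ : Ω₁ → PRM.NO C)
      (Ω₂ : Type w) (_ : MeasurableSpace Ω₂) (P₂ : Measure Ω₂) (N₂ : Ω₂ → PRM.NO C),
      PRM.IsPRM μ P₁ N₁ → PRM.IsPRM μ P₂ N₂ → P₁.map N₁ = P₂.map N₂) ∧
    -- Laplace functional
    (∀ (Ω : Type v) (_ : MeasurableSpace Ω) (P : Measure Ω) (N : Ω → PRM.NO C),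
      PRM.IsPRM μ P N → PRM.HasPoissonLaplace μ P N) ∧
    -- converse
    (∀ (Ω : Type v) (_ : MeasurableSpace Ω) (P : Measure Ω) (N : Ω → PRM.NO C),
      PRM.IsPointProcess P N → PRM.HasPoissonLaplace μ P N → PRM.IsPRM μ P N) := by
  have hCm := hC.measurableSet
  refine ⟨PRM.exists_isPRM hC μ, ?_, ?_, ?_⟩
  · intro Ω₁ _ P₁ N₁ Ω₂ _ P₂ N₂ h₁ h₂
    exact PRM.map_eq_of_laplace_eq hC h₁.1 h₂.1 fun g hg =>
      (h₁.laplace_eq hC hg).trans (h₂.laplace_eq hC hg).symm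
  · intro Ω _ P N h
    exact (PRM.hasPoissonLaplace_iff hCm).2 fun g hg => h.laplace_eq hC hg
  · intro Ω _ P N hN h
    exact PRM.isPRM_of_laplace hC hN ((PRM.hasPoissonLaplace_iff hCm).1 h)
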